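/- Let $n\ge 1$ and $d\ge 2n+1$ be integers, let $\nu\in\mathbb{R}$, and let $\eta=\mathrm{diag}(+1,-1,\dots,-1)$ be the Minkowski metric on $\mathbb{R}^{d}$, with which indices $b=0,\dots,d-1$ are raised and lowered. Consider formal power series $\phi(y,a)$, with coefficients in $\mathbb{R}$ or $\mathbb{C}$, in the commuting variables $y^b$ and $a_i^b$ ($i=1,\dots,n$), and the operators $$\Box=\frac{\partial^2}{\partial y^b\,\partial y_b},\qquad D^i=\frac{\partial^2}{\partial a_i^b\,\partial y_b},\qquad T^{ij}=\frac{\partial^2}{\partial a_i^b\,\partial a_{j\,b}} .$$ Separate the first oscillator from the other $n-1$, which are labelled by $\alpha,\beta$, and write $T=T^{11}$, $T^{\alpha}=T^{1\alpha}$ with $\alpha,\beta\in\{2,\dots,n\}$. A series $\phi_0$ is called totally traceless if $T^{ij}\phi_0=\Box\phi_0=D^i\phi_0=0$ for all $i,j$. Then: (0) The space of all formal series is the direct sum of the space of totally traceless series and the space of pure traces, i.e. of the sums $y^by_b\,g+a_i^b y_b\,g^i+a_i^b a_{j\,b}\,g^{ij}$ with arbitrary formal series $g,g^i,g^{ij}$.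 Let $\Pi$ denote the projector onto the totally traceless component along the pure traces. (1) For every totally traceless $\phi_0$ there exists a unique formal series $\phi$ such that $$\Pi\phi=\phi_0,\qquad (T+\nu)\phi=T^{\alpha}\phi=T^{\alpha\beta}\phi=\Box\phi=D^i\phi=0\qquad\text{for all }\alpha,\beta\in\{2,\dots,n\},\ i\in\{1,\dots,n\}.$$ (2) The map $\phi\mapsto\Pi\phi$ is a linear isomorphism from the space of solutions of $(T+\nu)\phi=T^{\alpha}\phi=T^{\alpha\beta}\phi=\Box\phi=D^i\phi=0$ onto the space of totally traceless series. -/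

import Mathlib

namespace ContinuousSpin

/-- The commuting variables. The pair `(none, b)` is the formal space-time coordinate `y^b`, and
`(some i, b)` is the auxiliary oscillator `a_i^b`, where `b = 0, …, d - 1` and `i = 0, …, n - 1`. -/
abbrev Var (n d : ℕ) : Type := Option (Fin n) × Fin d

/-- Formal power series in the variables `y^b` and `a_i^b`. -/
abbrev Series (𝕜 : Type*) (n d : ℕ) : Type _ := MvPowerSeries (Var n d) 𝕜

/-- The diagonal entries of the Minkowski metric `diag(+1, -1, …, -1)` (which is its own
inverse). -/
def eta (𝕜 : Type*) [Ring 𝕜] {d : ℕ} (b : Fin d) : 𝕜 := if (b : ℕ) = 0 then 1 else -1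

variable (𝕜 : Type*) [RCLike 𝕜] (n d : ℕ)

/-- The contracted second derivative `∑_b η^{bb} ∂/∂a_I^b ∂/∂a_J^b`, where each of `a_I`, `a_J` is
`y` or one of the oscillators. -/
noncomputable def contraction (I J : Option (Fin n)) : Series 𝕜 n d →ₗ[𝕜] Series 𝕜 n d :=
  ∑ b : Fin d, eta 𝕜 b •
    ((MvPowerSeries.pderiv 𝕜 ((I, b) : Var n d) : Series 𝕜 n d →ₗ[𝕜] Series 𝕜 n d) ∘ₗ
      (MvPowerSeries.pderiv 𝕜 ((J, b) : Var n d) : Series 𝕜 n d →ₗ[𝕜] Series 𝕜 n d))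

/-- The wave operator `□ = ∂²/∂y^b∂y_b`. -/
noncomputable def box : Series 𝕜 n d →ₗ[𝕜] Series 𝕜 n d := contraction 𝕜 n d none none

/-- The divergence `D^i = ∂²/∂a_i^b∂y_b`. -/
noncomputable def divergence (i : Fin n) : Series 𝕜 n d →ₗ[𝕜] Series 𝕜 n d :=
  contraction 𝕜 n d (some i) none

/-- The trace `T^{ij} = ∂²/∂a_i^b∂a_{j b}`. -/
noncomputable def trace (i j : Fin n) : Series 𝕜 n d →ₗ[𝕜] Series 𝕜 n d :=
  contraction 𝕜 n d (some i) (some j)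

/-- The invariant quadratic form `∑_b η_{bb} a_I^b a_J^b`, where each of `a_I`, `a_J` is `y` or one
of the oscillators. -/
noncomputable def quadric (I J : Option (Fin n)) : Series 𝕜 n d :=
  ∑ b : Fin d, eta 𝕜 b •
    ((MvPowerSeries.X ((I, b) : Var n d) : Series 𝕜 n d) * MvPowerSeries.X ((J, b) : Var n d))

/-- The totally traceless series: `T^{ij} φ = □ φ = D^i φ = 0`. -/
noncomputable def totallyTraceless : Submodule 𝕜 (Series 𝕜 n d) where
  carrier := {φ | (∀ i j, trace 𝕜 n d i j φ = 0) ∧ box 𝕜 n d φ = 0 ∧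
    ∀ i, divergence 𝕜 n d i φ = 0}
  zero_mem' := by simp
  add_mem' := by
    rintro φ ψ ⟨h₁, h₂, h₃⟩ ⟨k₁, k₂, k₃⟩
    simp_all
  smul_mem' := by
    rintro c φ ⟨h₁, h₂, h₃⟩
    simp_all

/-- The pure trace series, that is, the sums `∑_{I,J} (a_I · a_J) g^{IJ}` with arbitrary formal
series `g^{IJ}`, where `a_I`, `a_J` run through `y` and the oscillators. -/
noncomputable def pureTrace : Submodule 𝕜 (Series 𝕜 n d) :=
  (Ideal.span (Set.range fun p : Option (Fin n) × Option (Fin n) =>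
    quadric 𝕜 n d p.1 p.2)).restrictScalars 𝕜

/-- The solutions of the deformed constraints
`(T + ν) φ = T^α φ = T^{αβ} φ = □ φ = D^i φ = 0`. Here `T = T^{00}`, `T^α = T^{0α}`, with `0` the
first oscillator and `α`, `β` ranging over the others. -/
noncomputable def deformedSolutions [NeZero n] (ν : ℝ) : Submodule 𝕜 (Series 𝕜 n d) where
  carrier := {φ | trace 𝕜 n d 0 0 φ + (ν : 𝕜) • φ = 0 ∧
    (∀ α, α ≠ 0 → trace 𝕜 n d 0 α φ = 0) ∧
    (∀ α β, α ≠ 0 → β ≠ 0 → trace 𝕜 n d α β φ = 0) ∧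
    box 𝕜 n d φ = 0 ∧ ∀ i, divergence 𝕜 n d i φ = 0}
  zero_mem' := by simp
  add_mem' := by
    rintro φ ψ ⟨h₁, h₂, h₃, h₄, h₅⟩ ⟨k₁, k₂, k₃, k₄, k₅⟩
    refine ⟨?_, ?_, ?_, ?_, ?_⟩
    · rw [map_add, smul_add, add_add_add_comm, h₁, k₁, add_zero]
    · intro α hα
      rw [map_add, h₂ α hα, k₂ α hα, add_zero]
    · intro α β hα hβ
      rw [map_add, h₃ α β hα hβ, k₃ α β hα hβ, add_zero]
    · rw [map_add, h₄, k₄, add_zero]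
    · intro i
      rw [map_add, h₅, k₅, add_zero]
  smul_mem' := by
    rintro c φ ⟨h₁, h₂, h₃, h₄, h₅⟩
    refine ⟨?_, ?_, ?_, ?_, ?_⟩
    · rw [map_smul, smul_comm, ← smul_add, h₁, smul_zero]
    · intro α hα
      rw [map_smul, h₂ α hα, smul_zero]
    · intro α β hα hβ
      rw [map_smul, h₃ α β hα hβ, smul_zero]
    · rw [map_smul, h₄, smul_zero]
    · intro i
      rw [map_smul, h₅, smul_zero]

/-- The projector `Π` onto the totally traceless component, along the pure trace series. -/
noncomputable def tracelessProjector (h : IsCompl (totallyTraceless 𝕜 n d) (pureTrace 𝕜 n d)) :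
    Series 𝕜 n d →ₗ[𝕜] Series 𝕜 n d :=
  (totallyTraceless 𝕜 n d).projection (pureTrace 𝕜 n d) h

end ContinuousSpin

/-! The Fischer pairing `X ^ μ ↦ μ! φ_μ` identifies formal series with all linear functionals on
polynomials and makes differentiation adjoint to multiplication by a variable. Write `q_{IJ} = a_I ·
a_J`. A series satisfies the constraints with constants `c_{IJ}` iff it annihilates the ideal
generated by the `q_{IJ} - c_{IJ}`, and it is a pure trace iff it annihilates the traceless
polynomials `harmonics`. Everything thus reduces to one polynomial statement,
`isCompl_harmonics_constraintIdeal`: for symmetric `c`, the traceless polynomials are a complement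
of this ideal. Used with `c = 0` and with the deformation, it shows that the totally traceless
series and the deformed solutions are both complements of the pure traces, so projecting along the
latter is an isomorphism between them.

The sum is everything because a functional that kills both subspaces vanishes degree by degree, by
positivity of `∑ μ! |p_μ|²` (`eq_zero_of_contraction_eq_smul`). The intersection is zero because the
top degree part of an element of the deformed ideal lies in the undeformed one
(`homogeneousComponent_mem_constraintIdeal`), where positivity again applies. This is where `d ≥ 2n
+ 1` enters: in isotropic coordinates over `ℂ` the quadrics then have pairwise coprime leading
monomials for a suitable weight, so no cancellation of top degrees can produce new elements. -/

open MvPolynomial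

/-! ### The Fischer pairing between power series and polynomials. -/

section Fischer

variable {K σ : Type*} [Field K] [CharZero K]

/-- The product `μ! = ∏ᵢ μᵢ!` of the factorials of the entries of a multi-index. -/
def multiFactorial (μ : σ →₀ ℕ) : ℕ := μ.prod fun _ k => k.factorial

theorem multiFactorial_ne_zero (μ : σ →₀ ℕ) : multiFactorial μ ≠ 0 :=
  Finset.prod_ne_zero_iff.2 fun _ _ => Nat.factorial_ne_zero _

theorem multiFactorial_add_single (μ : σ →₀ ℕ) (v : σ) :
    multiFactorial (μ + Finsupp.single v 1) = multiFactorial μ * (μ v + 1) := by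
  classical
  have h (ν : σ →₀ ℕ) : multiFactorial ν = (ν v).factorial * multiFactorial (ν.erase v) :=
    (Finsupp.mul_prod_erase' ν v _ fun _ => rfl).symm
  rw [h, h μ, Finsupp.erase_add, Finsupp.erase_single]
  simp [Nat.factorial_succ]
  ring

/-- The Fischer pairing, which identifies formal power series with linear functionals on
polynomials: the functional attached to `φ` takes `X ^ μ` to `μ! φ_μ`. -/
noncomputable def fischer : MvPowerSeries σ K ≃ₗ[K] Module.Dual K (MvPolynomial σ K) :=
  (LinearEquiv.piCongrRight fun μ : σ →₀ ℕ => LinearEquiv.smulOfNeZero K K (multiFactorial μ : K)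
    (Nat.cast_ne_zero.2 (multiFactorial_ne_zero μ))).trans ((basisMonomials σ K).constr K)

theorem fischer_monomial_one (φ : MvPowerSeries σ K) (μ : σ →₀ ℕ) :
    fischer φ (monomial μ 1) = multiFactorial μ * MvPowerSeries.coeff μ φ := by
  have := (basisMonomials σ K).constr_basis K
    (fun μ => (multiFactorial μ : K) * MvPowerSeries.coeff μ φ) μ
  rwa [coe_basisMonomials] at this

theorem fischer_monomial (φ : MvPowerSeries σ K) (μ : σ →₀ ℕ) (r : K) :
    fischer φ (monomial μ r) = r * (multiFactorial μ * MvPowerSeries.coeff μ φ) := by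
  rw [← mul_one r, ← smul_eq_mul r 1, ← smul_monomial, map_smul, fischer_monomial_one]
  simp

/-- The normalisation `μ!` is chosen for this: `(μ + e_v)! = μ! (μ_v + 1)` supplies exactly the
factor produced by the derivative. -/
theorem fischer_pderiv (v : σ) (φ : MvPowerSeries σ K) (p : MvPolynomial σ K) :
    fischer (MvPowerSeries.pderiv K v φ) p = fischer φ (X v * p) := by
  induction p using MvPolynomial.induction_on' with
  | monomial μ r =>
    rw [X, monomial_mul, fischer_monomial, fischer_monomial, add_comm, multiFactorial_add_single,
      MvPowerSeries.coeff_pderiv]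
    push_cast
    ring
  | add p q hp hq => rw [mul_add, map_add, map_add, hp, hq]

theorem fischer_X_mul (v : σ) (φ : MvPowerSeries σ K) (p : MvPolynomial σ K) :
    fischer (MvPowerSeries.X v * φ) p = fischer φ (pderiv v p) := by
  classical
  induction p using MvPolynomial.induction_on' with
  | monomial μ r =>
    rw [pderiv_monomial, fischer_monomial, fischer_monomial]
    by_cases h : μ v = 0
    · have : MvPowerSeries.coeff μ (MvPowerSeries.X v * φ) = 0 := by
        rw [MvPowerSeries.X, MvPowerSeries.coeff_monomial_mul, if_neg]
        intro hle
        have := hle v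
        simp [h] at this
      simp [this, h]
    · have hle : Finsupp.single v 1 ≤ μ := by
        simpa [Finsupp.single_le_iff] using Nat.one_le_iff_ne_zero.2 h
      obtain ⟨ν, rfl⟩ := le_iff_exists_add.1 hle
      rw [add_tsub_cancel_left, add_comm, multiFactorial_add_single, MvPowerSeries.X, add_comm ν,
        MvPowerSeries.coeff_add_monomial_mul]
      simp
      ring
  | add p q hp hq => rw [map_add, map_add, map_add, hp, hq]

end Fischer

/-! ### Contractions and quadrics as adjoints; traceless polynomials and the constraint ideal span.
-/

namespace ContinuousSpin

variable {𝕜 : Type*} [RCLike 𝕜] {n d : ℕ}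

variable (𝕜 n d) in
/-- The polynomial `∑_b η_{bb} a_I^b a_J^b`. -/
noncomputable def polyQuadric (I J : Option (Fin n)) : MvPolynomial (Var n d) 𝕜 :=
  ∑ b : Fin d, eta 𝕜 b • (X (I, b) * X (J, b))

variable (𝕜 n d) in
/-- The operator `∑_b η^{bb} ∂/∂a_I^b ∂/∂a_J^b` on polynomials. -/
noncomputable def polyContraction (I J : Option (Fin n)) :
    MvPolynomial (Var n d) 𝕜 →ₗ[𝕜] MvPolynomial (Var n d) 𝕜 :=
  ∑ b : Fin d, eta 𝕜 b •
    ((pderiv ((I, b) : Var n d)).toLinearMap ∘ₗ (pderiv ((J, b) : Var n d)).toLinearMap)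

variable (𝕜 n d) in
/-- The totally traceless polynomials. -/
noncomputable def harmonics : Submodule 𝕜 (MvPolynomial (Var n d) 𝕜) :=
  LinearMap.ker (LinearMap.pi fun p : Option (Fin n) × Option (Fin n) =>
    polyContraction 𝕜 n d p.1 p.2)

theorem mem_harmonics {p : MvPolynomial (Var n d) 𝕜} :
    p ∈ harmonics 𝕜 n d ↔ ∀ I J, polyContraction 𝕜 n d I J p = 0 := by
  simp [harmonics, funext_iff]

/-- The ideal generated by the polynomials `a_I · a_J - c_{IJ}`. -/
noncomputable def constraintIdeal (d : ℕ) (c : Option (Fin n) → Option (Fin n) → 𝕜) :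
    Ideal (MvPolynomial (Var n d) 𝕜) :=
  Ideal.span (Set.range fun p : Option (Fin n) × Option (Fin n) =>
    polyQuadric 𝕜 n d p.1 p.2 - C (c p.1 p.2))

theorem contraction_apply (I J : Option (Fin n)) (φ : Series 𝕜 n d) :
    contraction 𝕜 n d I J φ = ∑ b : Fin d, eta 𝕜 b •
      MvPowerSeries.pderiv 𝕜 ((I, b) : Var n d) (MvPowerSeries.pderiv 𝕜 ((J, b) : Var n d) φ) := by
  simp [contraction]

theorem polyContraction_apply (I J : Option (Fin n)) (p : MvPolynomial (Var n d) 𝕜) :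
    polyContraction 𝕜 n d I J p =
      ∑ b : Fin d, eta 𝕜 b • pderiv ((I, b) : Var n d) (pderiv ((J, b) : Var n d) p) := by
  simp [polyContraction]

theorem pderiv_pderiv_comm {K σ : Type*} [CommSemiring K] (v w : σ) (φ : MvPowerSeries σ K) :
    MvPowerSeries.pderiv K v (MvPowerSeries.pderiv K w φ) =
      MvPowerSeries.pderiv K w (MvPowerSeries.pderiv K v φ) := by
  classical
  by_cases h : v = w
  · rw [h]
  ext μ
  simp only [MvPowerSeries.coeff_pderiv, Finsupp.add_apply, Finsupp.single_apply, if_neg h,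
    if_neg (Ne.symm h), add_right_comm μ (Finsupp.single v 1)]
  push_cast
  ring

theorem contraction_comm (I J : Option (Fin n)) :
    contraction 𝕜 n d I J = contraction 𝕜 n d J I := by
  ext1 φ
  simp_rw [contraction_apply, fun b => pderiv_pderiv_comm ((I, b) : Var n d) (J, b) φ]

theorem coe_polyContraction (I J : Option (Fin n)) (p : MvPolynomial (Var n d) 𝕜) :
    ((polyContraction 𝕜 n d I J p : MvPolynomial (Var n d) 𝕜) : Series 𝕜 n d) =
      contraction 𝕜 n d I J p := by
  ext μ
  simp [contraction_apply, polyContraction_apply, MvPolynomial.coeff_sum, coeff_pderiv,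
    MvPowerSeries.coeff_pderiv]

theorem fischer_contraction (I J : Option (Fin n)) (φ : Series 𝕜 n d)
    (p : MvPolynomial (Var n d) 𝕜) :
    fischer (contraction 𝕜 n d I J φ) p = fischer φ (polyQuadric 𝕜 n d I J * p) := by
  simp only [contraction_apply, polyQuadric, Finset.sum_mul, map_sum, LinearMap.sum_apply,
    map_smul, LinearMap.smul_apply, fischer_pderiv, smul_mul_assoc]
  exact Finset.sum_congr rfl fun b _ => by rw [mul_left_comm, mul_assoc]

theorem fischer_quadric_mul (I J : Option (Fin n)) (φ : Series 𝕜 n d)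
    (p : MvPolynomial (Var n d) 𝕜) :
    fischer (quadric 𝕜 n d I J * φ) p = fischer φ (polyContraction 𝕜 n d I J p) := by
  simp only [polyContraction_apply, quadric, Finset.sum_mul, map_sum, LinearMap.sum_apply,
    map_smul, LinearMap.smul_apply, smul_mul_assoc, mul_assoc, fischer_X_mul]
  refine Finset.sum_congr rfl fun b _ => ?_
  rw [← fischer_X_mul, ← fischer_X_mul, ← fischer_X_mul, ← fischer_X_mul, mul_left_comm]

/-- By adjointness, pairing `φ` with `p * (q_{IJ} - c_{IJ})` is pairing the defect of the constraint
on `φ` with `p`; a series is zero iff it pairs to zero with every `p`. -/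
theorem fischer_mem_dualAnnihilator_constraintIdeal {φ : Series 𝕜 n d}
    {c : Option (Fin n) → Option (Fin n) → 𝕜} :
    fischer φ ∈ ((constraintIdeal d c).restrictScalars 𝕜).dualAnnihilator ↔
      ∀ I J, contraction 𝕜 n d I J φ = c I J • φ := by
  have key (I J) (p : MvPolynomial (Var n d) 𝕜) :
      fischer φ (p * (polyQuadric 𝕜 n d I J - C (c I J))) =
        fischer (contraction 𝕜 n d I J φ - c I J • φ) p := by
    rw [map_sub, map_smul, LinearMap.sub_apply, fischer_contraction, mul_sub, map_sub, mul_comm p,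
      mul_comm p, C_mul', map_smul, LinearMap.smul_apply]
  constructor
  · intro h I J
    rw [← sub_eq_zero, ← (fischer (K := 𝕜) (σ := Var n d)).map_eq_zero_iff]
    ext1 μ
    refine LinearMap.ext fun r => ?_
    rw [LinearMap.comp_apply, ← key]
    exact (Submodule.mem_dualAnnihilator _).1 h _
      (Ideal.mul_mem_left _ _ (Ideal.subset_span ⟨(I, J), rfl⟩))
  · intro h
    refine (Submodule.mem_dualAnnihilator _).2 fun p hp => ?_
    -- The functional is only `𝕜`-linear, so the induction over the ideal has to carry all multiples
    -- of `p`.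
    have h_all : ∀ r, fischer φ (r * p) = 0 := by
      induction hp using Submodule.span_induction with
      | mem p hp =>
        obtain ⟨⟨I, J⟩, rfl⟩ := hp
        intro r
        rw [key, h, sub_self, map_zero, LinearMap.zero_apply]
      | zero => simp
      | add p q _ _ hp hq => exact fun r => by rw [mul_add, map_add, hp, hq, add_zero]
      | smul a p _ hp => exact fun r => by rw [smul_eq_mul, ← mul_assoc, hp]
    simpa using h_all 1

theorem polyContraction_map_conj (I J : Option (Fin n)) (p : MvPolynomial (Var n d) 𝕜) :
    polyContraction 𝕜 n d I J (map (starRingEnd 𝕜) p) =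
      map (starRingEnd 𝕜) (polyContraction 𝕜 n d I J p) := by
  have (b : Fin d) : starRingEnd 𝕜 (eta 𝕜 b) = eta 𝕜 b := by
    unfold eta; split_ifs <;> simp
  simp [polyContraction_apply, pderiv_map, smul_eq_C_mul, this]

/-- The Fischer form `⟨p, p⟩ = ∑ μ! |p_μ|²` is positive definite. -/
theorem eq_zero_of_fischer_map_conj {σ : Type*} {p : MvPolynomial σ 𝕜} {φ : MvPowerSeries σ 𝕜}
    (h : fischer φ p = 0)
    (hφ : ∀ μ ∈ p.support, starRingEnd 𝕜 (coeff μ p) = MvPowerSeries.coeff μ φ) : p = 0 := by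
  rw [p.as_sum, map_sum, Finset.sum_congr rfl fun μ hμ => by
    rw [fischer_monomial, ← hφ μ hμ, mul_left_comm, RCLike.mul_conj]] at h
  norm_cast at h
  rw [Finset.sum_eq_zero_iff_of_nonneg fun μ _ => by positivity] at h
  by_contra hp
  obtain ⟨μ, hμ⟩ := Finset.nonempty_iff_ne_empty.2 (mt support_eq_empty.1 hp)
  have := h μ hμ
  simp [multiFactorial_ne_zero] at this
  exact mem_support_iff.1 hμ this

/-- Traceless polynomials meet the ideal of the quadrics only in zero. -/
theorem eq_zero_of_mem_harmonics_of_mem_constraintIdeal {p : MvPolynomial (Var n d) 𝕜}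
    (hp : p ∈ harmonics 𝕜 n d)
    (hp' : p ∈ constraintIdeal d (0 : Option (Fin n) → Option (Fin n) → 𝕜)) : p = 0 := by
  -- Since `eta` is real, the conjugate of `p` is again traceless, so as a series it annihilates the
  -- ideal and in particular `p`.
  refine eq_zero_of_fischer_map_conj
    (φ := ((map (starRingEnd 𝕜) p : MvPolynomial (Var n d) 𝕜) : Series 𝕜 n d)) ?_
    fun μ _ => by rw [coeff_coe, coeff_map]
  refine (Submodule.mem_dualAnnihilator _).1
    (fischer_mem_dualAnnihilator_constraintIdeal.2 fun I J => ?_) p hp'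
  rw [← coe_polyContraction, polyContraction_map_conj, mem_harmonics.1 hp]
  simp

/-- Contractions lower the degree by two, so the contractions of the degree `D` part of `φ` are
multiples of its degree `D - 2` part, which vanishes by induction. The degree `D` part is therefore
traceless; pairing `φ` with its conjugate `p` gives a sum `∑ μ! |φ_μ|²`, which is zero by `hφ`. -/
theorem eq_zero_of_contraction_eq_smul {c : Option (Fin n) → Option (Fin n) → 𝕜} {φ : Series 𝕜 n d}
    (hc : ∀ I J, contraction 𝕜 n d I J φ = c I J • φ)
    (hφ : fischer φ ∈ (harmonics 𝕜 n d).dualAnnihilator) : φ = 0 := by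
  classical
  suffices h : ∀ (D : ℕ) (μ : Var n d →₀ ℕ), μ.degree = D → MvPowerSeries.coeff μ φ = 0 by
    ext μ
    exact h _ μ rfl
  intro D
  induction D using Nat.strong_induction_on with
  | _ D ih =>
  let p : MvPolynomial (Var n d) 𝕜 := ∑ μ ∈ Finset.univ.finsuppAntidiag D,
    monomial μ (starRingEnd 𝕜 (MvPowerSeries.coeff μ φ))
  have hcoeff (μ : Var n d →₀ ℕ) : coeff μ p =
      if μ.degree = D then starRingEnd 𝕜 (MvPowerSeries.coeff μ φ) else 0 := by
    simp [p, coeff_sum, coeff_monomial, Finsupp.degree_eq_sum]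
  have hp : p ∈ harmonics 𝕜 n d := by
    refine mem_harmonics.2 fun I J => ?_
    ext μ
    have hsum : coeff μ (polyContraction 𝕜 n d I J p) = if μ.degree + 2 = D then
        starRingEnd 𝕜 (MvPowerSeries.coeff μ (contraction 𝕜 n d I J φ)) else 0 := by
      have h_eta (b : Fin d) : starRingEnd 𝕜 (eta 𝕜 b) = eta 𝕜 b := by
        unfold eta; split_ifs <;> simp
      simp only [polyContraction_apply, contraction_apply, coeff_sum, coeff_smul, coeff_pderiv,
        MvPowerSeries.coeff_pderiv, hcoeff, map_add, Finsupp.degree_single, map_sum, smul_eq_mul,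
        MvPowerSeries.coeff_smul, map_mul, h_eta, add_assoc, Nat.reduceAdd]
      split_ifs <;> simp
    rw [hsum, hc, MvPowerSeries.coeff_smul]
    split_ifs with h
    · rw [ih μ.degree (by omega) μ rfl]
      simp
    · simp
  have hp0 : p = 0 := by
    refine eq_zero_of_fischer_map_conj ((Submodule.mem_dualAnnihilator _).1 hφ p hp) fun μ hμ => ?_
    rw [mem_support_iff, hcoeff] at hμ
    rw [hcoeff, if_pos (by by_contra h; simp [h] at hμ), RingHomCompTriple.comp_apply,
      RingHom.id_apply]
  intro μ hμ
  simpa [hμ, hp0] using (hcoeff μ).symm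

/-- Two subspaces span iff only the zero functional kills both, and every functional on polynomials
is a series. -/
theorem codisjoint_harmonics_constraintIdeal (c : Option (Fin n) → Option (Fin n) → 𝕜) :
    Codisjoint (harmonics 𝕜 n d) ((constraintIdeal d c).restrictScalars 𝕜) := by
  rw [codisjoint_iff, ← Subspace.dualAnnihilator_inj, Submodule.dualAnnihilator_sup_eq,
    Submodule.dualAnnihilator_top, eq_bot_iff]
  rintro f ⟨hf, hf'⟩
  obtain ⟨φ, rfl⟩ := (fischer (K := 𝕜) (σ := Var n d)).surjective f
  rw [eq_zero_of_contraction_eq_smul (fischer_mem_dualAnnihilator_constraintIdeal.1 hf') hf,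
    map_zero]
  exact Submodule.zero_mem _

end ContinuousSpin

/-! ### Leading parts with respect to a weight. -/

section TopPart

variable {K σ Γ : Type*} [Field K]

/-- `p₀` is homogeneous of weight `N`, and all monomials of `p - p₀` have smaller weight. -/
def IsTopPart (w : σ → ℕ) (N : ℕ) (p p₀ : MvPolynomial σ K) : Prop :=
  p₀.IsWeightedHomogeneous w N ∧ ∀ μ, N ≤ Finsupp.weight w μ → coeff μ (p - p₀) = 0

theorem coeff_mul_eq_zero_of_weight {w : σ → ℕ} {p q : MvPolynomial σ K} {N M : ℕ}
    (hp : ∀ μ, N ≤ Finsupp.weight w μ → coeff μ p = 0)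
    (hq : ∀ μ, M < Finsupp.weight w μ → coeff μ q = 0) (μ : σ →₀ ℕ)
    (hμ : N + M ≤ Finsupp.weight w μ) : coeff μ (p * q) = 0 := by
  classical
  rw [coeff_mul]
  refine Finset.sum_eq_zero fun x hx => ?_
  rw [← Finset.HasAntidiagonal.mem_antidiagonal.1 hx, map_add] at hμ
  by_cases h : N ≤ Finsupp.weight w x.1
  · rw [hp _ h, zero_mul]
  · rw [hq _ (by omega), mul_zero]

namespace IsTopPart

variable {w : σ → ℕ} {N M : ℕ} {p p₀ q q₀ : MvPolynomial σ K}

theorem of_isWeightedHomogeneous (h : p.IsWeightedHomogeneous w N) : IsTopPart w N p p :=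
  ⟨h, by simp⟩

theorem coeff_eq (h : IsTopPart w N p p₀) {μ : σ →₀ ℕ} (hμ : N ≤ Finsupp.weight w μ) :
    coeff μ p = coeff μ p₀ := by
  rw [← sub_eq_zero, ← coeff_sub, h.2 μ hμ]

theorem mul (hp : IsTopPart w N p p₀) (hq : IsTopPart w M q q₀) :
    IsTopPart w (N + M) (p * q) (p₀ * q₀) := by
  refine ⟨hp.1.mul hq.1, fun μ hμ => ?_⟩
  have key : p * q - p₀ * q₀ = (p - p₀) * q + (q - q₀) * p₀ := by ring
  rw [key, coeff_add, coeff_mul_eq_zero_of_weight hp.2 (fun ν hν => ?_) μ hμ,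
    coeff_mul_eq_zero_of_weight hq.2 (fun ν hν => ?_) μ (by rwa [add_comm]), add_zero]
  · exact hp.1.coeff_eq_zero ν hν.ne'
  · rw [hq.coeff_eq hν.le, hq.1.coeff_eq_zero ν hν.ne']

theorem one : IsTopPart w 0 (1 : MvPolynomial σ K) 1 :=
  of_isWeightedHomogeneous (isWeightedHomogeneous_one K w)

theorem pow (hp : IsTopPart w N p p₀) (k : ℕ) : IsTopPart w (k * N) (p ^ k) (p₀ ^ k) := by
  induction k with
  | zero => simpa using one
  | succ k ih => simpa only [pow_succ, Nat.succ_mul] using ih.mul hp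

theorem prod {N : Γ → ℕ} {p p₀ : Γ → MvPolynomial σ K} (s : Finset Γ)
    (h : ∀ γ ∈ s, IsTopPart w (N γ) (p γ) (p₀ γ)) :
    IsTopPart w (∑ γ ∈ s, N γ) (∏ γ ∈ s, p γ) (∏ γ ∈ s, p₀ γ) := by
  classical
  induction s using Finset.induction_on with
  | empty => simpa using one
  | insert γ s hγ ih =>
    rw [Finset.sum_insert hγ, Finset.prod_insert hγ, Finset.prod_insert hγ]
    exact (h γ (Finset.mem_insert_self _ _)).mul
      (ih fun δ hδ => h δ (Finset.mem_insert_of_mem hδ))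

end IsTopPart

end TopPart

theorem homogeneousComponent_totalDegree_ne_zero {K σ : Type*} [Field K] {p : MvPolynomial σ K}
    (hp : p ≠ 0) : homogeneousComponent p.totalDegree p ≠ 0 := by
  obtain ⟨μ, hμ, hdeg⟩ := Finset.exists_mem_eq_sup p.support
    (Finset.nonempty_iff_ne_empty.2 (mt support_eq_empty.1 hp)) fun s => s.sum fun _ e => e
  intro h
  have := congrArg (coeff μ) h
  rw [coeff_homogeneousComponent, if_pos (show μ.degree = p.totalDegree from hdeg.symm)] at this
  exact mem_support_iff.1 hμ this

/-! ### Triangular substitution for families with pairwise coprime leading monomials. -/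

section Triangular

variable {K σ Γ : Type*} [Field K] [Fintype Γ] {m : Γ → σ →₀ ℕ}

/-- The multiplicity of the monomial `X ^ m` in `X ^ μ`, for `m ≠ 0`. -/
noncomputable def multiplicityIn (m : σ →₀ ℕ) (hm : m.support.Nonempty) (μ : σ →₀ ℕ) : ℕ :=
  m.support.inf' hm fun v => μ v / m v

theorem multiplicityIn_smul_le (m : σ →₀ ℕ) (hm : m.support.Nonempty) (μ : σ →₀ ℕ) :
    multiplicityIn m hm μ • m ≤ μ := by
  intro v
  by_cases hv : v ∈ m.support
  · calc multiplicityIn m hm μ * m v ≤ μ v / m v * m v :=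
        Nat.mul_le_mul_right _ (Finset.inf'_le _ hv)
      _ ≤ μ v := Nat.div_mul_le_self _ _
  · simp [Finsupp.notMem_support_iff.1 hv]

theorem multiplicityIn_add_self (m : σ →₀ ℕ) (hm : m.support.Nonempty) (μ : σ →₀ ℕ) :
    multiplicityIn m hm (μ + m) = multiplicityIn m hm μ + 1 := by
  have h1 : multiplicityIn m hm (μ + m) = m.support.inf' hm fun v => μ v / m v + 1 :=
    Finset.inf'_congr _ rfl fun v hv =>
      Nat.add_div_right _ (Nat.pos_of_ne_zero (Finsupp.mem_support_iff.1 hv))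
  rw [h1]
  exact (Finset.apply_inf'_eq_inf'_comp hm (fun k : ℕ => k + 1) fun a b =>
    (Nat.add_min_add_right a b 1).symm).symm

theorem multiplicityIn_add_of_disjoint {m m' : σ →₀ ℕ} (hm : m.support.Nonempty)
    (h : Disjoint m.support m'.support) (μ : σ →₀ ℕ) :
    multiplicityIn m hm (μ + m') = multiplicityIn m hm μ :=
  Finset.inf'_congr _ rfl fun v hv => by
    rw [Finsupp.add_apply, Finsupp.notMem_support_iff.1 (Finset.disjoint_left.1 h hv), add_zero]

/-- The remainder of the exponent `μ` after the monomials `X ^ m γ` have been divided out. -/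
noncomputable def monomialRemainder (hm : ∀ γ, (m γ).support.Nonempty) (μ : σ →₀ ℕ) : σ →₀ ℕ :=
  μ - ∑ γ, multiplicityIn (m γ) (hm γ) μ • m γ

variable (hm : ∀ γ, (m γ).support.Nonempty)

theorem sum_add_monomialRemainder
    (hdisj : Pairwise fun γ δ => Disjoint (m γ).support (m δ).support) (μ : σ →₀ ℕ) :
    ∑ γ, multiplicityIn (m γ) (hm γ) μ • m γ + monomialRemainder hm μ = μ := by
  refine add_tsub_cancel_of_le fun v => ?_
  rw [Finsupp.finsetSum_apply]
  by_cases h : ∃ γ, v ∈ (m γ).support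
  · obtain ⟨γ, hγ⟩ := h
    rw [Finset.sum_eq_single γ]
    · exact multiplicityIn_smul_le (m γ) (hm γ) μ v
    · intro δ _ hδ
      simp [Finsupp.notMem_support_iff.1 (Finset.disjoint_left.1 (hdisj hδ.symm) hγ)]
    · simp
  · push Not at h
    rw [Finset.sum_eq_zero fun γ _ => by simp [Finsupp.notMem_support_iff.1 (h γ)]]
    exact Nat.zero_le _


theorem multiplicityIn_add {Γ : Type*} [DecidableEq Γ] {m : Γ → σ →₀ ℕ}
    (hm : ∀ γ, (m γ).support.Nonempty)
    (hdisj : Pairwise fun γ δ => Disjoint (m γ).support (m δ).support) (μ : σ →₀ ℕ) (γ δ : Γ) :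
    multiplicityIn (m δ) (hm δ) (μ + m γ) =
      multiplicityIn (m δ) (hm δ) μ + if δ = γ then 1 else 0 := by
  split_ifs with h
  · rw [h, multiplicityIn_add_self]
  · rw [multiplicityIn_add_of_disjoint _ (hdisj h), add_zero]

theorem monomialRemainder_add
    (hdisj : Pairwise fun γ δ => Disjoint (m γ).support (m δ).support) (μ : σ →₀ ℕ) (γ : Γ) :
    monomialRemainder hm (μ + m γ) = monomialRemainder hm μ := by
  classical
  refine add_left_cancel (a := ∑ δ, multiplicityIn (m δ) (hm δ) (μ + m γ) • m δ) ?_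
  rw [sum_add_monomialRemainder hm hdisj]
  conv_lhs => rw [← sum_add_monomialRemainder hm hdisj μ]
  simp only [multiplicityIn_add hm hdisj, add_smul, Finset.sum_add_distrib, ite_smul, one_smul,
    zero_smul, Finset.sum_ite_eq', Finset.mem_univ, if_true]
  exact add_right_comm _ _ _

/-- The linear map that replaces, in each monomial, every power of `X ^ m γ` by the same power of
`f γ`. -/
noncomputable def leadMap (f : Γ → MvPolynomial σ K) : MvPolynomial σ K →ₗ[K] MvPolynomial σ K :=
  (basisMonomials σ K).constr K fun μ =>
    (∏ γ, f γ ^ multiplicityIn (m γ) (hm γ) μ) * monomial (monomialRemainder hm μ) 1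

variable {f f₀ : Γ → MvPolynomial σ K}

theorem leadMap_monomial (μ : σ →₀ ℕ) (r : K) : leadMap hm f (monomial μ r) =
    r • ((∏ γ, f γ ^ multiplicityIn (m γ) (hm γ) μ) * monomial (monomialRemainder hm μ) 1) := by
  have := (basisMonomials σ K).constr_basis K (fun μ =>
    (∏ γ, f γ ^ multiplicityIn (m γ) (hm γ) μ) * monomial (monomialRemainder hm μ) (1 : K)) μ
  rw [coe_basisMonomials] at this
  rw [← mul_one r, ← smul_eq_mul r 1, ← smul_monomial, map_smul, leadMap, this]
  simp

/-- Although `leadMap` is not multiplicative, this suffices to make the ideal of the `f γ` the image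
of the monomial ideal of the `X ^ m γ`, once `leadMap` is surjective. -/
theorem leadMap_monomial_mul (hdisj : Pairwise fun γ δ => Disjoint (m γ).support (m δ).support)
    (γ : Γ) (p : MvPolynomial σ K) :
    leadMap hm f (monomial (m γ) 1 * p) = f γ * leadMap hm f p := by
  classical
  induction p using MvPolynomial.induction_on' with
  | monomial μ r =>
    rw [monomial_mul, one_mul, leadMap_monomial, leadMap_monomial, add_comm,
      monomialRemainder_add hm hdisj, mul_smul_comm, ← mul_assoc]
    simp only [multiplicityIn_add hm hdisj, pow_add, Finset.prod_mul_distrib, pow_ite, pow_one,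
      pow_zero, Finset.prod_ite_eq', Finset.mem_univ, if_true]
    rw [mul_comm (∏ _, _)]
  | add p q hp hq => rw [mul_add, map_add, map_add, hp, hq, mul_add]

theorem isTopPart_leadMap (hdisj : Pairwise fun γ δ => Disjoint (m γ).support (m δ).support)
    {w : σ → ℕ} (hf : ∀ γ, IsTopPart w (Finsupp.weight w (m γ)) (f γ) (f₀ γ)) (μ : σ →₀ ℕ) :
    IsTopPart w (Finsupp.weight w μ) (leadMap hm f (monomial μ 1))
      (leadMap hm f₀ (monomial μ 1)) := by
  rw [leadMap_monomial, leadMap_monomial, one_smul, one_smul]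
  conv => enter [2]; rw [← sum_add_monomialRemainder hm hdisj μ, map_add, map_sum]
  simp only [map_nsmul, smul_eq_mul]
  exact (IsTopPart.prod _ fun γ _ => (hf γ).pow _).mul
    (.of_isWeightedHomogeneous (isWeightedHomogeneous_monomial _ _ _ rfl))

theorem leadMap_monomial_self (hdisj : Pairwise fun γ δ => Disjoint (m γ).support (m δ).support)
    (μ : σ →₀ ℕ) : leadMap hm (fun γ => monomial (m γ) (1 : K)) (monomial μ 1) = monomial μ 1 := by
  rw [leadMap_monomial, one_smul]
  simp only [monomial_pow, one_pow]
  rw [← monomial_sum_one, monomial_mul, one_mul, sum_add_monomialRemainder hm hdisj]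

/-- All `f γ` have the leading monomial `X ^ m γ` with respect to the weight `w`. -/
def HasLeadingMonomials (m : Γ → σ →₀ ℕ) (w : σ → ℕ) (f : Γ → MvPolynomial σ K) : Prop :=
  ∀ γ, IsTopPart w (Finsupp.weight w (m γ)) (f γ) (monomial (m γ) 1)

theorem isTopPart_leadMap_monomial
    (hdisj : Pairwise fun γ δ => Disjoint (m γ).support (m δ).support)
    {w : σ → ℕ} (hf : HasLeadingMonomials m w f) (μ : σ →₀ ℕ) :
    IsTopPart w (Finsupp.weight w μ) (leadMap hm f (monomial μ 1)) (monomial μ 1) := by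
  simpa only [leadMap_monomial_self hm hdisj] using isTopPart_leadMap hm hdisj hf μ

/-- `leadMap` is unitriangular: it fixes each monomial up to terms of smaller weight, and weights
are natural numbers. -/
theorem leadMap_surjective (hdisj : Pairwise fun γ δ => Disjoint (m γ).support (m δ).support)
    {w : σ → ℕ} (hf : HasLeadingMonomials m w f) : Function.Surjective (leadMap hm f) := by
  rw [← LinearMap.range_eq_top, eq_top_iff]
  have hspan {p : MvPolynomial σ K}
      (hp : ∀ μ ∈ p.support, monomial μ 1 ∈ LinearMap.range (leadMap hm f)) :
      p ∈ LinearMap.range (leadMap hm f) := by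
    rw [p.as_sum]
    refine Submodule.sum_mem _ fun μ hμ => ?_
    rw [← mul_one (coeff μ p), ← smul_eq_mul (coeff μ p) 1, ← smul_monomial]
    exact Submodule.smul_mem _ _ (hp μ hμ)
  suffices h : ∀ (N : ℕ) (μ : σ →₀ ℕ), Finsupp.weight w μ = N →
      monomial μ 1 ∈ LinearMap.range (leadMap hm f) from fun p _ => hspan fun μ _ => h _ μ rfl
  intro N
  induction N using Nat.strong_induction_on with
  | _ N ih =>
  rintro μ rfl
  rw [← sub_sub_cancel (leadMap hm f (monomial μ 1)) (monomial μ 1)]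
  refine Submodule.sub_mem _ ⟨_, rfl⟩ (hspan fun ν hν => ih _ ?_ ν rfl)
  by_contra! hle
  exact mem_support_iff.1 hν ((isTopPart_leadMap_monomial hm hdisj hf μ).2 ν hle)

/-- The coefficient of `p` at a monomial of maximal weight survives unchanged in the image. -/
theorem leadMap_injective (hdisj : Pairwise fun γ δ => Disjoint (m γ).support (m δ).support)
    {w : σ → ℕ} (hf : HasLeadingMonomials m w f) : Function.Injective (leadMap hm f) := by
  classical
  rw [injective_iff_map_eq_zero]
  intro p hp
  by_contra hp0
  obtain ⟨μ, hμ, hmax⟩ := Finset.exists_max_image p.support (Finsupp.weight w)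
    (Finset.nonempty_iff_ne_empty.2 (mt support_eq_empty.1 hp0))
  have h := congrArg (coeff μ) hp
  rw [p.as_sum, map_sum, coeff_sum, coeff_zero, Finset.sum_congr rfl fun ν hν => by
    rw [← mul_one (coeff ν p), ← smul_eq_mul (coeff ν p) 1, ← smul_monomial, map_smul, coeff_smul,
      (isTopPart_leadMap_monomial hm hdisj hf ν).coeff_eq (hmax ν hν), coeff_monomial]] at h
  simp only [smul_eq_mul, mul_ite, mul_one, mul_zero, Finset.sum_ite_eq', if_pos hμ] at h
  exact mem_support_iff.1 hμ h

theorem homogeneousComponent_leadMap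
    (hdisj : Pairwise fun γ δ => Disjoint (m γ).support (m δ).support)
    (hf : ∀ γ, IsTopPart 1 (Finsupp.weight 1 (m γ)) (f γ) (f₀ γ)) {p : MvPolynomial σ K} {N : ℕ}
    (hp : p.totalDegree ≤ N) : homogeneousComponent N (leadMap hm f p) =
      leadMap hm f₀ (homogeneousComponent N p) := by
  classical
  conv_lhs => rw [p.as_sum]
  conv_rhs => rw [p.as_sum]
  simp only [map_sum]
  refine Finset.sum_congr rfl fun μ hμ => ?_
  have hμN : μ.degree ≤ N := (le_totalDegree hμ).trans hp
  have h := isTopPart_leadMap hm hdisj hf μ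
  have hdeg (ν : σ →₀ ℕ) : Finsupp.weight (1 : σ → ℕ) ν = ν.degree :=
    (DFunLike.congr_fun Finsupp.degree_eq_weight_one ν).symm
  rw [hdeg] at h
  rw [← mul_one (coeff μ p), ← smul_eq_mul (coeff μ p) 1, ← smul_monomial]
  simp only [map_smul]
  congr 1
  rw [homogeneousComponent_of_mem (n := μ.degree) (isHomogeneous_monomial _ rfl)]
  ext ν
  rw [coeff_homogeneousComponent]
  split_ifs with h1 h2 h2
  · rw [h.coeff_eq (by rw [hdeg]; omega)]
  · rw [h.coeff_eq (by rw [hdeg]; omega), map_zero, coeff_zero]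
    exact h.1.coeff_eq_zero ν (by rw [hdeg]; omega)
  · rw [eq_comm]
    exact h.1.coeff_eq_zero ν (by rw [hdeg]; omega)
  · simp

/-- If the polynomials `f γ` have top degree parts `f₀ γ`, and both families have the pairwise
coprime leading monomials `X ^ m γ`, then the top degree parts of the elements of the ideal spanned
by the `f γ` lie in the ideal spanned by the `f₀ γ`. -/
theorem homogeneousComponent_mem_span_range (hm : ∀ γ, (m γ).support.Nonempty)
    (hdisj : Pairwise fun γ δ => Disjoint (m γ).support (m δ).support)
    {w : σ → ℕ} (hf : HasLeadingMonomials m w f) (hf₀ : HasLeadingMonomials m w f₀)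
    (hff₀ : ∀ γ, IsTopPart 1 (Finsupp.weight 1 (m γ)) (f γ) (f₀ γ)) {h : MvPolynomial σ K} {D : ℕ}
    (hh : h ∈ Ideal.span (Set.range f)) (hD : h.totalDegree ≤ D) :
    homogeneousComponent D h ∈ Ideal.span (Set.range f₀) := by
  classical
  obtain ⟨c, rfl⟩ := Ideal.mem_span_range_iff_exists_fun.1 hh
  -- Pulling the cofactors back through `leadMap` writes the given element as the image of `p` in
  -- the monomial ideal.
  choose q hq using fun γ => leadMap_surjective hm hdisj hf (c γ)
  obtain ⟨p, hp⟩ : ∃ p, p = ∑ γ, monomial (m γ) 1 * q γ := ⟨_, rfl⟩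
  have hLp : leadMap hm f p = ∑ γ, c γ * f γ := by
    rw [hp, map_sum]
    exact Finset.sum_congr rfl fun γ _ => by rw [leadMap_monomial_mul hm hdisj, hq, mul_comm]
  rw [← hLp] at hD ⊢
  -- No top degree cancels: otherwise the top component of `p` would be a nonzero element killed by
  -- the injective `leadMap hm f₀`.
  have hpD : p.totalDegree ≤ D := by
    by_contra! hlt
    have h0 : homogeneousComponent p.totalDegree p = 0 := by
      refine leadMap_injective hm hdisj hf₀ ?_
      rw [← homogeneousComponent_leadMap hm hdisj hff₀ le_rfl, map_zero]
      exact homogeneousComponent_eq_zero _ _ (hD.trans_lt hlt)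
    have hp0 : p ≠ 0 := by
      rintro rfl
      simp at hlt
    exact homogeneousComponent_totalDegree_ne_zero hp0 h0
  rw [homogeneousComponent_leadMap hm hdisj hff₀ hpD, hp, map_sum, map_sum]
  refine Ideal.sum_mem _ fun γ _ => ?_
  -- The homogeneous components of a multiple of a monomial are again multiples of that monomial.
  induction q γ using MvPolynomial.induction_on' with
  | monomial μ r =>
    rw [monomial_mul, homogeneousComponent_of_mem (n := (m γ + μ).degree)
      (isHomogeneous_monomial _ rfl)]
    split_ifs
    · rw [← monomial_mul, leadMap_monomial_mul hm hdisj]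
      exact Ideal.mul_mem_right _ _ (Ideal.subset_span ⟨γ, rfl⟩)
    · rw [map_zero]
      exact Ideal.zero_mem _
  | add a b ha hb =>
    rw [mul_add, map_add, map_add]
    exact Ideal.add_mem _ ha hb

end Triangular

/-! ### Membership tests for polynomials of low weight. -/

section LowWeight

variable {K σ : Type*} [Field K]

/-- The polynomials all of whose monomials have weight less than `N`. -/
noncomputable def lowWeight (K : Type*) [Field K] (w : σ → ℕ) (N : ℕ) :
    Submodule K (MvPolynomial σ K) where
  carrier := {p | ∀ μ, N ≤ Finsupp.weight w μ → coeff μ p = 0}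
  zero_mem' := by simp
  add_mem' hp hq μ hμ := by rw [coeff_add, hp μ hμ, hq μ hμ, add_zero]
  smul_mem' c p hp μ hμ := by rw [coeff_smul, hp μ hμ, smul_zero]

theorem X_mul_X_mem_lowWeight {w : σ → ℕ} {N : ℕ} {a b : σ} (h : w a + w b < N) :
    (X a * X b : MvPolynomial σ K) ∈ lowWeight K w N := by
  classical
  intro μ hμ
  rw [X, X, monomial_mul, coeff_monomial, if_neg]
  rintro rfl
  simp [Finsupp.weight_single] at hμ
  omega

theorem C_mem_lowWeight {w : σ → ℕ} {N : ℕ} (h : 0 < N) (r : K) : C r ∈ lowWeight K w N := by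
  classical
  intro μ hμ
  rw [coeff_C, if_neg]
  rintro rfl
  simp at hμ
  omega

theorem isTopPart_of_sub_mem_lowWeight {w : σ → ℕ} {N : ℕ} {p p₀ : MvPolynomial σ K}
    (h₀ : p₀.IsWeightedHomogeneous w N) (h : p - p₀ ∈ lowWeight K w N) : IsTopPart w N p p₀ :=
  ⟨h₀, h⟩

end LowWeight

/-! ### Isotropic coordinates and coprime leading monomials of the quadrics. -/

namespace ContinuousSpin

/-- Labels of isotropic coordinates: one unpaired coordinate `w`, `n` hyperbolic pairs `u k`, `v k`,
and `e` further coordinates. -/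
inductive SplitIndex (n e : ℕ) : Type
  | w : SplitIndex n e
  | u (k : Fin n) : SplitIndex n e
  | v (k : Fin n) : SplitIndex n e
  | x (j : Fin e) : SplitIndex n e
  deriving DecidableEq

/-- The coordinate labels as a sum type. -/
def splitIndexEquiv (n e : ℕ) : SplitIndex n e ≃ (Unit ⊕ Fin e) ⊕ (Fin n ⊕ Fin n) where
  toFun
    | .w => .inl (.inl ())
    | .u k => .inr (.inl k)
    | .v k => .inr (.inr k)
    | .x j => .inl (.inr j)
  invFun
    | .inl (.inl _) => .w
    | .inr (.inl k) => .u k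
    | .inr (.inr k) => .v k
    | .inl (.inr j) => .x j
  left_inv c := by cases c <;> rfl
  right_inv c := by rcases c with (c | c) | (c | c) <;> rfl

instance (n e : ℕ) : Fintype (SplitIndex n e) := Fintype.ofEquiv _ (splitIndexEquiv n e).symm

theorem sum_splitIndex {n e : ℕ} {M : Type*} [AddCommMonoid M] (g : SplitIndex n e → M) :
    ∑ c, g c = g .w + ∑ j, g (.x j) + ∑ k, (g (.u k) + g (.v k)) := by
  rw [← (splitIndexEquiv n e).symm.sum_comp]
  simp only [Fintype.sum_sum_type, Finset.univ_unique, Finset.sum_singleton,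
    Finset.sum_add_distrib]
  rfl

theorem nonempty_splitIndex_equiv {n d : ℕ} (hd : 2 * n + 1 ≤ d) :
    Nonempty (SplitIndex n (d - (2 * n + 1)) ≃ Fin d) :=
  ⟨Fintype.equivFinOfCardEq (by
    rw [Fintype.card_congr (splitIndexEquiv n _)]
    simp
    omega)⟩

variable {n e : ℕ}

/-- The quadric `a_I · a_J` in isotropic coordinates. -/
noncomputable def splitQuadric (e : ℕ) (I J : Option (Fin n)) :
    MvPolynomial (Option (Fin n) × SplitIndex n e) ℂ :=
  X (I, .w) * X (J, .w) + ∑ j, X (I, .x j) * X (J, .x j) +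
    ∑ k, (X (I, .u k) * X (J, .v k) + X (I, .v k) * X (J, .u k))

theorem splitQuadric_comm (I J : Option (Fin n)) : splitQuadric e I J = splitQuadric e J I := by
  unfold splitQuadric
  congr 1
  · congr 1
    · exact mul_comm _ _
    · exact Finset.sum_congr rfl fun _ _ => mul_comm _ _
  · exact Finset.sum_congr rfl fun _ _ => by ring

theorem isHomogeneous_splitQuadric (I J : Option (Fin n)) :
    (splitQuadric e I J).IsHomogeneous 2 := by
  have h (a b : Option (Fin n) × SplitIndex n e) :
      (X a * X b : MvPolynomial (Option (Fin n) × SplitIndex n e) ℂ).IsHomogeneous 2 :=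
    (isHomogeneous_X ℂ a).mul (isHomogeneous_X ℂ b)
  exact ((h _ _).add (.sum _ _ _ fun _ _ => h _ _)).add
    (.sum _ _ _ fun _ _ => (h _ _).add (h _ _))

/-- The position of a vector variable: `0` for `y` and `i + 1` for `a_i`. -/
def vecRank (I : Option (Fin n)) : ℕ := I.elim 0 fun i => i + 1

theorem vecRank_le (I : Option (Fin n)) : vecRank I ≤ n := by
  cases I with
  | none => exact Nat.zero_le _
  | some i => exact i.2

theorem vecRank_injective : Function.Injective (vecRank (n := n)) := by
  rintro (_ | i) (_ | j) h <;> simp_all [vecRank, Fin.ext_iff]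

/-- A weight for which the `splitQuadric`s have pairwise coprime leading monomials. -/
def splitWeight : Option (Fin n) × SplitIndex n e → ℕ
  | (_, .w) => 3 * n ^ 2 + 1
  | (I, .u k) => 3 * n ^ 2 + 1 - (2 * vecRank I * (k + 1) + (k + 1) ^ 2)
  | (I, .v k) => 3 * n ^ 2 + 1 + 2 * vecRank I * (k + 1)
  | (_, .x _) => 3 * n ^ 2

/-- Ordered pairs of vector variables. -/
abbrev OrderedPair (n : ℕ) : Type :=
  {p : Option (Fin n) × Option (Fin n) // vecRank p.1 ≤ vecRank p.2}

/-- The two variables whose product is the leading monomial of the quadric of an ordered pair. -/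
def leadingVars (e : ℕ) (γ : OrderedPair n) :
    (Option (Fin n) × SplitIndex n e) × (Option (Fin n) × SplitIndex n e) :=
  if h : vecRank γ.1.1 < vecRank γ.1.2 then
    ((γ.1.1, .u ⟨vecRank γ.1.2 - vecRank γ.1.1 - 1, by have := vecRank_le γ.1.2; omega⟩),
      (γ.1.2, .v ⟨vecRank γ.1.2 - vecRank γ.1.1 - 1, by have := vecRank_le γ.1.2; omega⟩))
  else ((γ.1.1, .w), (γ.1.2, .w))

/-- The exponent of the leading monomial of the quadric of an ordered pair. -/
noncomputable def leadingExponent (e : ℕ) (γ : OrderedPair n) :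
    Option (Fin n) × SplitIndex n e →₀ ℕ :=
  Finsupp.single (leadingVars e γ).1 1 + Finsupp.single (leadingVars e γ).2 1

theorem support_leadingExponent (γ : OrderedPair n) :
    (leadingExponent e γ).support = {(leadingVars e γ).1, (leadingVars e γ).2} := by
  ext v
  simp [leadingExponent, Finsupp.single_apply]
  grind

theorem support_leadingExponent_nonempty (γ : OrderedPair n) :
    (leadingExponent e γ).support.Nonempty := by
  rw [support_leadingExponent]
  exact Finset.insert_nonempty _ _

/-- Each variable determines its pair: `(I, .u k)` forces `vecRank J = vecRank I + k + 1`, likewise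
`(J, .v k)` determines `I`, and `(I, .w)` occurs only for `(I, I)`. -/
theorem disjoint_support_leadingExponent : Pairwise fun γ δ : OrderedPair n =>
    Disjoint (leadingExponent e γ).support (leadingExponent e δ).support := by
  intro γ δ hne
  rw [Finset.disjoint_left]
  intro v hv hv'
  apply hne
  rw [support_leadingExponent] at hv hv'
  obtain ⟨⟨I, J⟩, h⟩ := γ
  obtain ⟨⟨I', J'⟩, h'⟩ := δ
  have hI : vecRank I = vecRank I' → I = I' := fun h => vecRank_injective h
  have hJ : vecRank J = vecRank J' → J = J' := fun h => vecRank_injective h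
  have hIJ : vecRank I = vecRank J → I = J := fun h => vecRank_injective h
  have hIJ' : vecRank I' = vecRank J' → I' = J' := fun h => vecRank_injective h
  simp only [leadingVars, Finset.mem_insert, Finset.mem_singleton] at hv hv'
  simp only [Subtype.mk.injEq, Prod.mk.injEq]
  simp only at h h'
  split_ifs at hv hv' <;> rcases hv with rfl | rfl <;>
    simp only [Prod.mk.injEq, SplitIndex.u.injEq, SplitIndex.v.injEq, reduceCtorEq, and_false,
      or_false, false_or, Fin.mk.injEq, and_true] at hv' <;> grind

theorem monomial_leadingExponent (γ : OrderedPair n) :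
    (monomial (leadingExponent e γ) 1 : MvPolynomial (Option (Fin n) × SplitIndex n e) ℂ) =
      X (leadingVars e γ).1 * X (leadingVars e γ).2 := by
  rw [X, X, monomial_mul, one_mul, leadingExponent]

theorem weight_leadingExponent (w : Option (Fin n) × SplitIndex n e → ℕ) (γ : OrderedPair n) :
    Finsupp.weight w (leadingExponent e γ) = w (leadingVars e γ).1 + w (leadingVars e γ).2 := by
  simp [leadingExponent, Finsupp.weight_single]

/-- The base weight `3 * n ^ 2 + 1` is large enough that the natural subtraction in `splitWeight`
never truncates, as `vecRank I` and `k + 1` are at most `n`. -/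
theorem splitWeight_u_add_eq (I : Option (Fin n)) (k : Fin n) :
    (splitWeight (e := e) (I, .u k) : ℤ) =
      3 * n ^ 2 + 1 - (2 * vecRank I * (k + 1) + (k + 1) ^ 2) := by
  have h1 := vecRank_le I
  have h2 : (k : ℕ) + 1 ≤ n := k.2
  have : 2 * vecRank I * (k + 1) + (k + 1) ^ 2 ≤ 3 * n ^ 2 + 1 := by nlinarith
  rw [splitWeight, Nat.cast_sub this]
  push_cast
  ring

/-- Put `δ = vecRank J - vecRank I` and `s = k + 1`. Relative to twice the base weight, `u_k v_k`
for `(I, J)` has weight `2sδ - s² = δ² - (s - δ)²`, with its unique maximum at `s = δ` if `δ > 0`.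
The opposite product `v_k u_k` has weight `-2sδ - s² < 0`, the product of the `w` has weight `0`,
and the `x` terms have weight `-2`. For `δ = 0` the `w` term wins. -/
theorem splitQuadric_hasLeadingMonomials (c : Option (Fin n) → Option (Fin n) → ℂ) :
    HasLeadingMonomials (leadingExponent e) splitWeight
      fun γ : OrderedPair n => splitQuadric e γ.1.1 γ.1.2 - C (c γ.1.1 γ.1.2) := by
  rintro ⟨⟨I, J⟩, hIJ⟩
  refine isTopPart_of_sub_mem_lowWeight (isWeightedHomogeneous_monomial _ _ _ rfl) ?_
  rw [monomial_leadingExponent, weight_leadingExponent]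
  have hw (K : Option (Fin n)) : splitWeight (e := e) (K, .w) = 3 * n ^ 2 + 1 := rfl
  have hv (K : Option (Fin n)) (k : Fin n) : (splitWeight (e := e) (K, .v k) : ℤ) =
      3 * n ^ 2 + 1 + 2 * vecRank K * (k + 1) := by simp [splitWeight]
  have hx (K : Option (Fin n)) (j : Fin e) : splitWeight (K, .x j) = 3 * n ^ 2 := rfl
  simp only at hIJ ⊢
  rcases hIJ.lt_or_eq with hlt | heq
  · obtain ⟨k, hk, hlead⟩ : ∃ k : Fin n, vecRank J = vecRank I + (k + 1) ∧
        leadingVars e ⟨(I, J), hIJ⟩ = ((I, .u k), (J, .v k)) :=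
      ⟨⟨vecRank J - vecRank I - 1, by have := vecRank_le J; omega⟩, by simp only; omega,
        dif_pos hlt⟩
    rw [hlead]
    obtain ⟨N, hN⟩ : ∃ N, N = splitWeight (e := e) (I, .u k) + splitWeight (e := e) (J, .v k) :=
      ⟨_, rfl⟩
    have hNz : (N : ℤ) = 2 * (3 * n ^ 2 + 1) + (k + 1) ^ 2 := by
      rw [hN]
      push_cast
      rw [splitWeight_u_add_eq, hv, hk]
      push_cast
      ring
    have hN2 : 2 * (3 * n ^ 2 + 1) < N := by zify; rw [hNz]; nlinarith
    rw [← hN, splitQuadric, Finset.sum_add_distrib,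
      ← Finset.add_sum_erase _ (fun k => X (I, SplitIndex.u k) * X (J, SplitIndex.v k))
        (Finset.mem_univ k)]
    have key : ∀ a b c' f g h : MvPolynomial (Option (Fin n) × SplitIndex n e) ℂ,
        a + b + (f + c' + g) - h - f = a + b + (c' + g) - h := fun _ _ _ _ _ _ => by ring
    rw [key]
    refine sub_mem (add_mem (add_mem (X_mul_X_mem_lowWeight ?_)
      (sum_mem fun j _ => X_mul_X_mem_lowWeight ?_))
      (add_mem (sum_mem fun l hl => X_mul_X_mem_lowWeight ?_)
        (sum_mem fun l _ => X_mul_X_mem_lowWeight ?_))) (C_mem_lowWeight (by omega) _)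
    · rw [hw, hw]; omega
    · rw [hx, hx]; omega
    · zify
      rw [splitWeight_u_add_eq, hv, hNz, hk]
      have hne : (k : ℤ) - l ≠ 0 := by
        intro h
        exact Finset.ne_of_mem_erase hl (Fin.ext (by omega))
      -- This square is the amount by which the weight of the `l`-th product falls short of `N`.
      have : 0 < ((k : ℤ) - l) ^ 2 := by positivity
      push_cast
      nlinarith
    · zify
      rw [splitWeight_u_add_eq, hv, hNz, hk]
      push_cast
      nlinarith
  · obtain rfl := vecRank_injective heq
    have hlead : leadingVars e ⟨(I, I), hIJ⟩ = ((I, .w), (I, .w)) := dif_neg (lt_irrefl _)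
    rw [hlead, hw, splitQuadric]
    have key : ∀ a b c' h : MvPolynomial (Option (Fin n) × SplitIndex n e) ℂ,
        a + b + c' - h - a = b + c' - h := fun _ _ _ _ => by ring
    rw [key]
    have huv (k : Fin n) : splitWeight (e := e) (I, .u k) + splitWeight (e := e) (I, .v k) <
        3 * n ^ 2 + 1 + (3 * n ^ 2 + 1) := by
      zify
      rw [splitWeight_u_add_eq, hv]
      nlinarith
    exact sub_mem (add_mem (sum_mem fun j _ => X_mul_X_mem_lowWeight (by rw [hx]; omega))
      (sum_mem fun k _ => add_mem (X_mul_X_mem_lowWeight (huv k))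
        (X_mul_X_mem_lowWeight (by rw [add_comm]; exact huv k)))) (C_mem_lowWeight (by omega) _)

theorem splitQuadric_isTopPart (c : Option (Fin n) → Option (Fin n) → ℂ) (γ : OrderedPair n) :
    IsTopPart 1 (Finsupp.weight 1 (leadingExponent e γ))
      (splitQuadric e γ.1.1 γ.1.2 - C (c γ.1.1 γ.1.2)) (splitQuadric e γ.1.1 γ.1.2) := by
  rw [weight_leadingExponent]
  refine isTopPart_of_sub_mem_lowWeight (isHomogeneous_splitQuadric _ _) ?_
  rw [sub_sub_cancel_left]
  exact neg_mem (C_mem_lowWeight (by simp) _)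

/-! ### Linear changes of variables between the original and the isotropic coordinates. -/

/-- Linear substitutions commute with taking homogeneous components. -/
theorem homogeneousComponent_aeval {K σ τ : Type*} [Field K] {g : σ → MvPolynomial τ K}
    (hg : ∀ i, (g i).IsHomogeneous 1) (N : ℕ) (p : MvPolynomial σ K) :
    homogeneousComponent N (aeval g p) = aeval g (homogeneousComponent N p) := by
  classical
  induction p using MvPolynomial.induction_on' with
  | monomial μ r =>
    rw [homogeneousComponent_of_mem (n := μ.degree) (isHomogeneous_monomial _ rfl),
      homogeneousComponent_of_mem (n := μ.degree)
        (by simpa using (isHomogeneous_monomial (R := K) (d := μ) r rfl).aeval g hg)]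
    split_ifs <;> simp
  | add p q hp hq => rw [map_add, map_add, map_add, map_add, hp, hq]

theorem totalDegree_aeval_le {K σ τ : Type*} [Field K] {g : σ → MvPolynomial τ K}
    (hg : ∀ i, (g i).IsHomogeneous 1) {D : ℕ} {p : MvPolynomial σ K} (hp : p.totalDegree ≤ D) :
    (aeval g p).totalDegree ≤ D := by
  rw [← sum_homogeneousComponent p, map_sum]
  refine totalDegree_finsetSum_le fun i hi => ?_
  rw [← homogeneousComponent_aeval hg]
  exact (homogeneousComponent_isHomogeneous _ _).totalDegree_le.trans
    (by have := Finset.mem_range.1 hi; omega)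

variable {n d e : ℕ}

/-- A square root of `η_{bb}`. -/
noncomputable def sqrtEta (b : Fin d) : ℂ := if (b : ℕ) = 0 then 1 else Complex.I

theorem sqrtEta_ne_zero (b : Fin d) : sqrtEta b ≠ 0 := by
  unfold sqrtEta
  split_ifs <;> simp

theorem eta_mul_sqrtEta_inv (b : Fin d) : eta ℂ b * ((sqrtEta b)⁻¹ * (sqrtEta b)⁻¹) = 1 := by
  unfold sqrtEta eta
  split_ifs <;> simp

/-- Orthonormal coordinates in terms of isotropic ones. -/
noncomputable def orthonormalForm (I : Option (Fin n)) :
    SplitIndex n e → MvPolynomial (Option (Fin n) × SplitIndex n e) ℂ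
  | .w => X (I, .w)
  | .u k => X (I, .u k) + C (1 / 2) * X (I, .v k)
  | .v k => C Complex.I * (X (I, .u k) - C (1 / 2) * X (I, .v k))
  | .x j => X (I, .x j)

/-- Polarisation of `(u + v/2)² + (i (u - v/2))² = 2uv`. -/
theorem sum_orthonormalForm (I J : Option (Fin n)) :
    ∑ c, orthonormalForm (e := e) I c * orthonormalForm J c = splitQuadric e I J := by
  rw [sum_splitIndex, splitQuadric]
  congr 1
  refine Finset.sum_congr rfl fun k _ => ?_
  simp only [orthonormalForm]
  have hI : (C Complex.I * C Complex.I : MvPolynomial (Option (Fin n) × SplitIndex n e) ℂ) = -1 := by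
    rw [← C_mul, Complex.I_mul_I, C_neg, C_1]
  have h2 : (C (1 / 2) + C (1 / 2) : MvPolynomial (Option (Fin n) × SplitIndex n e) ℂ) = 1 := by
    rw [← C_add, add_halves, C_1]
  linear_combination (X (I, SplitIndex.u k) - C (1 / 2) * X (I, .v k)) *
    (X (J, .u k) - C (1 / 2) * X (J, .v k)) * hI +
    (X (I, .u k) * X (J, .v k) + X (I, .v k) * X (J, .u k)) * h2

/-- The coordinates of the original variables in terms of isotropic ones. -/
noncomputable def toSplit (E : SplitIndex n e ≃ Fin d) (i : Var n d) :
    MvPolynomial (Option (Fin n) × SplitIndex n e) ℂ :=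
  C (sqrtEta i.2)⁻¹ * orthonormalForm i.1 (E.symm i.2)

/-- The isotropic coordinates in terms of the original variables. -/
noncomputable def ofSplit (E : SplitIndex n e ≃ Fin d) :
    Option (Fin n) × SplitIndex n e → MvPolynomial (Var n d) ℂ
  | (I, .w) => C (sqrtEta (E .w)) * X (I, E .w)
  | (I, .u k) => C (1 / 2) * (C (sqrtEta (E (.u k))) * X (I, E (.u k)) -
      C Complex.I * (C (sqrtEta (E (.v k))) * X (I, E (.v k))))
  | (I, .v k) => C (sqrtEta (E (.u k))) * X (I, E (.u k)) +
      C Complex.I * (C (sqrtEta (E (.v k))) * X (I, E (.v k)))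
  | (I, .x j) => C (sqrtEta (E (.x j))) * X (I, E (.x j))

theorem toSplit_isHomogeneous (E : SplitIndex n e ≃ Fin d) (i : Var n d) :
    (toSplit E i).IsHomogeneous 1 := by
  refine IsHomogeneous.C_mul ?_ _
  cases E.symm i.2 with
  | w => exact isHomogeneous_X _ _
  | u k => exact (isHomogeneous_X _ _).add ((isHomogeneous_X _ _).C_mul _)
  | v k => exact ((isHomogeneous_X _ _).sub ((isHomogeneous_X _ _).C_mul _)).C_mul _
  | x j => exact isHomogeneous_X _ _

theorem aeval_ofSplit_orthonormalForm (E : SplitIndex n e ≃ Fin d) (I : Option (Fin n))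
    (c : SplitIndex n e) :
    aeval (ofSplit E) (orthonormalForm I c) = C (sqrtEta (E c)) * X (I, E c) := by
  have hI : (C Complex.I * C Complex.I : MvPolynomial (Var n d) ℂ) = -1 := by
    rw [← C_mul, Complex.I_mul_I, C_neg, C_1]
  have h2 : (C (1 / 2) + C (1 / 2) : MvPolynomial (Var n d) ℂ) = 1 := by
    rw [← C_add, add_halves, C_1]
  cases c with
  | w => simp [orthonormalForm, ofSplit]
  | u k =>
    simp only [orthonormalForm, ofSplit, map_add, map_mul, aeval_X, aeval_C, algebraMap_eq]
    linear_combination C (sqrtEta (E (.u k))) * X (I, E (.u k)) * h2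
  | v k =>
    simp only [orthonormalForm, ofSplit, map_sub, map_mul, aeval_X, aeval_C, algebraMap_eq]
    linear_combination -C (sqrtEta (E (.v k))) * X (I, E (.v k)) * (C (1 / 2) + C (1 / 2)) * hI +
      C (sqrtEta (E (.v k))) * X (I, E (.v k)) * h2
  | x j => simp [orthonormalForm, ofSplit]

theorem aeval_ofSplit_aeval_toSplit (E : SplitIndex n e ≃ Fin d) (p : MvPolynomial (Var n d) ℂ) :
    aeval (ofSplit E) (aeval (toSplit E) p) = p := by
  suffices h : (aeval (ofSplit E)).comp (aeval (toSplit E)) = AlgHom.id ℂ _ from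
    DFunLike.congr_fun h p
  refine algHom_ext fun i => ?_
  rw [AlgHom.comp_apply, aeval_X, toSplit, map_mul, aeval_ofSplit_orthonormalForm, aeval_C,
    algebraMap_eq, Equiv.apply_symm_apply, ← mul_assoc, ← C_mul, inv_mul_cancel₀ (sqrtEta_ne_zero _),
    C_1, one_mul, AlgHom.id_apply]

theorem aeval_toSplit_polyQuadric (E : SplitIndex n e ≃ Fin d) (I J : Option (Fin n)) :
    aeval (toSplit E) (polyQuadric ℂ n d I J) = splitQuadric e I J := by
  rw [← sum_orthonormalForm, polyQuadric, map_sum, ← E.symm.sum_comp]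
  refine Finset.sum_congr rfl fun b _ => ?_
  rw [map_smul, map_mul, aeval_X, aeval_X, toSplit, toSplit, mul_mul_mul_comm, ← C_mul,
    smul_eq_C_mul, ← mul_assoc, ← C_mul, eta_mul_sqrtEta_inv, C_1, one_mul]

/-- The top degree part of an element of the ideal of the deformed constraints lies in the ideal of
the undeformed ones. -/
theorem homogeneousComponent_mem_constraintIdeal (hd : 2 * n + 1 ≤ d)
    {c : Option (Fin n) → Option (Fin n) → ℂ} (hc : ∀ I J, c I J = c J I)
    {h : MvPolynomial (Var n d) ℂ} (hh : h ∈ constraintIdeal d c) {D : ℕ}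
    (hD : h.totalDegree ≤ D) :
    homogeneousComponent D h ∈ constraintIdeal d (0 : Option (Fin n) → Option (Fin n) → ℂ) := by
  -- Differences of ranks run through `1, …, n` and each needs its own hyperbolic pair; the diagonal
  -- quadrics need one more coordinate, hence `2n + 1`.
  obtain ⟨E⟩ := nonempty_splitIndex_equiv hd
  obtain ⟨f, hf⟩ : ∃ f : (Option (Fin n) → Option (Fin n) → ℂ) → OrderedPair n →
      MvPolynomial (Option (Fin n) × SplitIndex n (d - (2 * n + 1))) ℂ,
      f = fun c γ => splitQuadric _ γ.1.1 γ.1.2 - C (c γ.1.1 γ.1.2) := ⟨_, rfl⟩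
  have hmem : aeval (toSplit E) h ∈ Ideal.span (Set.range (f c)) := by
    suffices hle : constraintIdeal d c ≤ (Ideal.span (Set.range (f c))).comap
        (aeval (toSplit E)) from hle hh
    refine Ideal.span_le.2 ?_
    rintro _ ⟨⟨I, J⟩, rfl⟩
    rw [SetLike.mem_coe, Ideal.mem_comap, map_sub, aeval_toSplit_polyQuadric, aeval_C,
      algebraMap_eq]
    rcases le_total (vecRank I) (vecRank J) with hIJ | hIJ
    · exact Ideal.subset_span ⟨⟨(I, J), hIJ⟩, by rw [hf]⟩
    · exact Ideal.subset_span ⟨⟨(J, I), hIJ⟩, by rw [hf, hc I J, splitQuadric_comm I J]⟩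
  have htop := homogeneousComponent_mem_span_range (f₀ := f 0) (w := splitWeight)
    support_leadingExponent_nonempty disjoint_support_leadingExponent
    (by rw [hf]; exact splitQuadric_hasLeadingMonomials c)
    (by rw [hf]; exact splitQuadric_hasLeadingMonomials 0)
    (fun γ => by simpa [hf] using splitQuadric_isTopPart c γ) hmem
    (totalDegree_aeval_le (toSplit_isHomogeneous E) hD)
  rw [homogeneousComponent_aeval (toSplit_isHomogeneous E)] at htop
  rw [← aeval_ofSplit_aeval_toSplit E (homogeneousComponent D h)]
  suffices hle : Ideal.span (Set.range (f 0)) ≤ (constraintIdeal d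
      (0 : Option (Fin n) → Option (Fin n) → ℂ)).comap (aeval (ofSplit E)) from hle htop
  refine Ideal.span_le.2 ?_
  rintro _ ⟨⟨⟨I, J⟩, _⟩, rfl⟩
  rw [SetLike.mem_coe, Ideal.mem_comap, hf]
  simp only [map_sub]
  rw [← aeval_toSplit_polyQuadric E, aeval_ofSplit_aeval_toSplit]
  exact Ideal.subset_span ⟨(I, J), by simp⟩

/-! ### Traceless polynomials complement the constraint ideal. -/

theorem homogeneousComponent_polyContraction (I J : Option (Fin n)) (N : ℕ)
    (p : MvPolynomial (Var n d) ℂ) : polyContraction ℂ n d I J (homogeneousComponent (N + 2) p) =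
      homogeneousComponent N (polyContraction ℂ n d I J p) := by
  ext μ
  simp only [polyContraction_apply, coeff_sum, coeff_smul, coeff_pderiv,
    coeff_homogeneousComponent, map_add, Finsupp.degree_single, add_assoc, Nat.reduceAdd,
    add_left_inj]
  split_ifs <;> simp

theorem homogeneousComponent_mem_harmonics {p : MvPolynomial (Var n d) ℂ}
    (hp : p ∈ harmonics ℂ n d) (N : ℕ) : homogeneousComponent N p ∈ harmonics ℂ n d := by
  rw [mem_harmonics] at hp ⊢
  intro I J
  ext μ
  have h := congrArg (coeff μ) (homogeneousComponent_polyContraction I J μ.degree p)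
  rw [hp, map_zero, coeff_zero] at h
  rw [coeff_zero]
  by_cases hN : N = μ.degree + 2
  · rw [hN, h]
  · simp only [polyContraction_apply, coeff_sum, coeff_smul, coeff_pderiv,
      coeff_homogeneousComponent, map_add, Finsupp.degree_single, add_assoc, Nat.reduceAdd,
      if_neg (Ne.symm hN), zero_mul, smul_zero, Finset.sum_const_zero]

/-- The top component of a nonzero `p` would be traceless and in the undeformed ideal, hence zero by
Fischer positivity. -/
theorem eq_zero_of_mem_harmonics_of_mem_constraintIdeal_complex (hd : 2 * n + 1 ≤ d)
    {c : Option (Fin n) → Option (Fin n) → ℂ} (hc : ∀ I J, c I J = c J I)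
    {p : MvPolynomial (Var n d) ℂ} (hp : p ∈ harmonics ℂ n d) (hp' : p ∈ constraintIdeal d c) :
    p = 0 := by
  by_contra hp0
  exact homogeneousComponent_totalDegree_ne_zero hp0
    (eq_zero_of_mem_harmonics_of_mem_constraintIdeal (homogeneousComponent_mem_harmonics hp _)
      (homogeneousComponent_mem_constraintIdeal hd hc hp' le_rfl))

/-- Isotropic coordinates need `√-1`; disjointness over `𝕜` is deduced from that over `ℂ` along this
embedding. -/
theorem exists_ringHom_complex (𝕜 : Type*) [RCLike 𝕜] : Nonempty (𝕜 →+* ℂ) := by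
  rcases RCLike.I_eq_zero_or_im_I_eq_one (K := 𝕜) with h | h
  · exact ⟨Complex.ofRealHom.comp (RCLike.realRingEquiv h : 𝕜 →+* ℝ)⟩
  · exact ⟨(RCLike.complexRingEquiv h : 𝕜 →+* ℂ)⟩

variable {𝕜 : Type*} [RCLike 𝕜]

theorem map_eta (ι : 𝕜 →+* ℂ) (b : Fin d) : ι (eta 𝕜 b) = eta ℂ b := by
  unfold eta
  split_ifs <;> simp

theorem map_polyQuadric (ι : 𝕜 →+* ℂ) (I J : Option (Fin n)) :
    map ι (polyQuadric 𝕜 n d I J) = polyQuadric ℂ n d I J := by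
  simp [polyQuadric, smul_eq_C_mul, map_eta]

theorem map_polyContraction (ι : 𝕜 →+* ℂ) (I J : Option (Fin n))
    (p : MvPolynomial (Var n d) 𝕜) :
    map ι (polyContraction 𝕜 n d I J p) = polyContraction ℂ n d I J (map ι p) := by
  simp [polyContraction_apply, smul_eq_C_mul, map_eta, pderiv_map]

theorem isCompl_harmonics_constraintIdeal (hd : 2 * n + 1 ≤ d)
    {c : Option (Fin n) → Option (Fin n) → 𝕜} (hc : ∀ I J, c I J = c J I) :
    IsCompl (harmonics 𝕜 n d) ((constraintIdeal d c).restrictScalars 𝕜) := by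
  refine ⟨?_, codisjoint_harmonics_constraintIdeal c⟩
  rw [Submodule.disjoint_def]
  intro p hp hp'
  obtain ⟨ι⟩ := exists_ringHom_complex 𝕜
  refine (map_injective ι ι.injective) ?_
  rw [map_zero]
  refine eq_zero_of_mem_harmonics_of_mem_constraintIdeal_complex hd (c := fun I J => ι (c I J))
    (fun I J => by rw [hc]) (mem_harmonics.2 fun I J => ?_) ?_
  · rw [← map_polyContraction, mem_harmonics.1 hp, map_zero]
  · suffices hle : constraintIdeal d c ≤ (constraintIdeal d fun I J => ι (c I J)).comap (map ι) from
      hle hp'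
    refine Ideal.span_le.2 ?_
    rintro _ ⟨⟨I, J⟩, rfl⟩
    rw [SetLike.mem_coe, Ideal.mem_comap, map_sub, map_polyQuadric, map_C]
    exact Ideal.subset_span ⟨(I, J), rfl⟩

/-! ### Translation back to power series. -/

theorem comap_fischer_dualAnnihilator_constraintIdeal_zero :
    (((constraintIdeal d (0 : Option (Fin n) → Option (Fin n) → 𝕜)).restrictScalars
      𝕜).dualAnnihilator).comap (fischer (K := 𝕜) (σ := Var n d)).toLinearMap =
      totallyTraceless 𝕜 n d := by
  ext φ
  rw [Submodule.mem_comap, LinearEquiv.coe_coe, fischer_mem_dualAnnihilator_constraintIdeal]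
  simp only [Pi.zero_apply, zero_smul]
  constructor
  · exact fun h => ⟨fun i j => h _ _, h _ _, fun i => h _ _⟩
  · rintro ⟨h1, h2, h3⟩ (_ | i) (_ | j)
    · exact h2
    · rw [contraction_comm]
      exact h3 j
    · exact h3 i
    · exact h1 i j

/-- The functionals killing a joint kernel are those factoring through the joint map. The finitely
many components of the second factor are arbitrary functionals, that is, series `g^{IJ}`, and
precomposing with a contraction is multiplying by its quadric. -/
theorem comap_fischer_dualAnnihilator_harmonics :
    (harmonics 𝕜 n d).dualAnnihilator.comap (fischer (K := 𝕜) (σ := Var n d)).toLinearMap =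
      pureTrace 𝕜 n d := by
  ext φ
  rw [Submodule.mem_comap, LinearEquiv.coe_coe]
  have hpure : φ ∈ pureTrace 𝕜 n d ↔ ∃ g : Option (Fin n) × Option (Fin n) → Series 𝕜 n d,
      ∑ p, g p * quadric 𝕜 n d p.1 p.2 = φ := Ideal.mem_span_range_iff_exists_fun
  rw [hpure]
  have hsum (g : Option (Fin n) × Option (Fin n) → Series 𝕜 n d) (q : MvPolynomial (Var n d) 𝕜) :
      fischer (∑ p, g p * quadric 𝕜 n d p.1 p.2) q =
        ∑ p, fischer (g p) (polyContraction 𝕜 n d p.1 p.2 q) := by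
    rw [map_sum, LinearMap.sum_apply]
    exact Finset.sum_congr rfl fun p _ => by rw [mul_comm, fischer_quadric_mul]
  constructor
  · intro h
    rw [harmonics, ← LinearMap.range_dualMap_eq_dualAnnihilator_ker] at h
    obtain ⟨ψ, hψ⟩ := h
    refine ⟨fun p => fischer.symm (ψ ∘ₗ LinearMap.single 𝕜 (fun _ => MvPolynomial (Var n d) 𝕜) p),
      fischer.injective ?_⟩
    refine LinearMap.ext fun q => ?_
    rw [hsum, ← hψ, LinearMap.dualMap_apply]
    simp only [LinearEquiv.apply_symm_apply, LinearMap.comp_apply, ← map_sum]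
    congr 1
    exact LinearMap.sum_single_apply _ _
  · rintro ⟨g, rfl⟩
    refine (Submodule.mem_dualAnnihilator _).2 fun q hq => ?_
    rw [hsum]
    exact Finset.sum_eq_zero fun p _ => by rw [mem_harmonics.1 hq, map_zero]

variable (𝕜) in
/-- The constants of the deformed constraints. -/
noncomputable def deformation [NeZero n] (ν : ℝ) (I J : Option (Fin n)) : 𝕜 :=
  if I = some 0 ∧ J = some 0 then -(ν : 𝕜) else 0

theorem comap_fischer_dualAnnihilator_constraintIdeal_deformation [NeZero n] (ν : ℝ) :
    (((constraintIdeal d (deformation (n := n) 𝕜 ν)).restrictScalars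
      𝕜).dualAnnihilator).comap (fischer (K := 𝕜) (σ := Var n d)).toLinearMap =
      deformedSolutions 𝕜 n d ν := by
  ext φ
  rw [Submodule.mem_comap, LinearEquiv.coe_coe, fischer_mem_dualAnnihilator_constraintIdeal]
  constructor
  · intro h
    refine ⟨?_, fun α hα => ?_, fun α β hα _ => ?_, ?_, fun i => ?_⟩
    · have := h (some 0) (some 0)
      rw [trace, this]
      simp [deformation]
    · simpa [trace, deformation, hα] using h (some 0) (some α)
    · simpa [trace, deformation, hα] using h (some α) (some β)
    · simpa [trace, box, divergence, deformation] using h none none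
    · simpa [trace, box, divergence, deformation] using h (some i) none
  · rintro ⟨h1, h2, h3, h4, h5⟩ (_ | i) (_ | j)
    · simpa [trace, box, divergence, deformation] using h4
    · rw [contraction_comm]
      simpa [trace, box, divergence, deformation] using h5 j
    · simpa [trace, box, divergence, deformation] using h5 i
    · by_cases hi : i = 0 <;> by_cases hj : j = 0
      · subst hi hj
        simpa [trace, box, divergence, deformation] using eq_neg_of_add_eq_zero_left h1
      · subst hi
        simpa [trace, box, divergence, deformation, hj] using h2 j hj
      · subst hj
        rw [contraction_comm]
        simpa [trace, box, divergence, deformation, hi] using h2 i hi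
      · simpa [trace, box, divergence, deformation, hi] using h3 i j hi hj

/-- Annihilators of complements are complements. The second summand does not depend on `c`, which is
what allows two values of `c` to be compared. -/
theorem isCompl_comap_fischer (hd : 2 * n + 1 ≤ d)
    {c : Option (Fin n) → Option (Fin n) → 𝕜} (hc : ∀ I J, c I J = c J I) :
    IsCompl ((((constraintIdeal d c).restrictScalars 𝕜).dualAnnihilator).comap
      (fischer (K := 𝕜) (σ := Var n d)).toLinearMap) (pureTrace 𝕜 n d) := by
  rw [← comap_fischer_dualAnnihilator_harmonics]
  exact (Subspace.isCompl_dualAnnihilator (isCompl_harmonics_constraintIdeal hd hc).symm).map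
    (Submodule.orderIsoMapComap (fischer (K := 𝕜) (σ := Var n d))).symm

end ContinuousSpin

theorem mainTheorem4 (𝕜 : Type*) [RCLike 𝕜] (n d : ℕ) [NeZero n] (hd : 2 * n + 1 ≤ d) (ν : ℝ) :
    ∃ h : IsCompl (ContinuousSpin.totallyTraceless 𝕜 n d) (ContinuousSpin.pureTrace 𝕜 n d),
      (∀ φ₀ ∈ ContinuousSpin.totallyTraceless 𝕜 n d,
        ∃! φ : ContinuousSpin.Series 𝕜 n d,
          ContinuousSpin.tracelessProjector 𝕜 n d h φ = φ₀ ∧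
          φ ∈ ContinuousSpin.deformedSolutions 𝕜 n d ν) ∧
      ∃ e : ContinuousSpin.deformedSolutions 𝕜 n d ν ≃ₗ[𝕜]
          ContinuousSpin.totallyTraceless 𝕜 n d,
        ∀ φ : ContinuousSpin.deformedSolutions 𝕜 n d ν,
          (e φ : ContinuousSpin.Series 𝕜 n d) =
            ContinuousSpin.tracelessProjector 𝕜 n d h (φ : ContinuousSpin.Series 𝕜 n d) := by
  have h : IsCompl (ContinuousSpin.totallyTraceless 𝕜 n d) (ContinuousSpin.pureTrace 𝕜 n d) := by
    rw [← ContinuousSpin.comap_fischer_dualAnnihilator_constraintIdeal_zero]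
    exact ContinuousSpin.isCompl_comap_fischer hd fun _ _ => rfl
  have h' : IsCompl (ContinuousSpin.deformedSolutions 𝕜 n d ν)
      (ContinuousSpin.pureTrace 𝕜 n d) := by
    rw [← ContinuousSpin.comap_fischer_dualAnnihilator_constraintIdeal_deformation]
    exact ContinuousSpin.isCompl_comap_fischer hd fun I J => by
      simp only [ContinuousSpin.deformation, and_comm]
  -- Two complements of the same subspace are identified by projecting along it: the kernel is the
  -- intersection of `h'`, and a preimage of `φ₀` is its component in the decomposition `h'`.
  let e : ContinuousSpin.deformedSolutions 𝕜 n d ν ≃ₗ[𝕜]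
      ContinuousSpin.totallyTraceless 𝕜 n d :=
    LinearEquiv.ofBijective (Submodule.projectionOnto _ _ h ∘ₗ Submodule.subtype _) <| by
      constructor
      · rw [injective_iff_map_eq_zero]
        intro φ hφ
        exact Subtype.ext (Submodule.disjoint_def.1 h'.disjoint φ φ.2
          ((Submodule.projectionOnto_apply_eq_zero_iff h).1 hφ))
      · intro φ₀
        obtain ⟨φ, hφ, g, hg, hsum⟩ := Submodule.mem_sup.1
          (h'.sup_eq_top ▸ Submodule.mem_top : (φ₀ : ContinuousSpin.Series 𝕜 n d) ∈ _)
        refine ⟨⟨φ, hφ⟩, ?_⟩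
        rw [LinearMap.comp_apply, Submodule.subtype_apply]
        have := congrArg (Submodule.projectionOnto _ _ h) hsum
        rwa [map_add, (Submodule.projectionOnto_apply_eq_zero_iff h).2 hg, add_zero,
          Submodule.projectionOnto_apply_left] at this
  have he (φ : ContinuousSpin.deformedSolutions 𝕜 n d ν) :
      (e φ : ContinuousSpin.Series 𝕜 n d) =
        ContinuousSpin.tracelessProjector 𝕜 n d h (φ : ContinuousSpin.Series 𝕜 n d) := rfl
  refine ⟨h, fun φ₀ hφ₀ => ?_, e, he⟩
  refine ⟨e.symm ⟨φ₀, hφ₀⟩, ⟨by rw [← he, e.apply_symm_apply], Subtype.coe_prop _⟩, ?_⟩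
  rintro φ ⟨hφ, hφ'⟩
  have : e ⟨φ, hφ'⟩ = ⟨φ₀, hφ₀⟩ := Subtype.ext ((he ⟨φ, hφ'⟩).trans hφ)
  rw [← this, e.symm_apply_apply]
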